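/- Let $\mathcal A$ be a unital $C^*$-algebra and let $H_{\mathcal A}=\ell^2(\mathcal A)$ be the standard Hilbert $\mathcal A$-module of sequences $x=(x_i)_{i\in\mathbb N}$ in $\mathcal A$ for which $\sum_i x_ix_i^*$ converges in norm, with coordinatewise left multiplication by $\mathcal A$, inner product $\langle x,y\rangle=\sum_i y_ix_i^*$ and norm $\|x\|=\|\langle x,x\rangle\|^{1/2}$ (replacing $\mathcal A$ by its opposite algebra gives the convention with right modules and $\langle x,y\rangle=\sum_i x_i^*y_i$). Let $B^a(H_{\mathcal A})$ be the algebra of all bounded adjointable $\mathcal A$-linear operators on $H_{\mathcal A}$. For $F\in B^a(H_{\mathcal A})$ consider decompositions $$H_{\mathcal A}=M_1\,\tilde\oplus\,N_1\xrightarrow{\;F\;}M_2\,\tilde\oplus\,N_2=H_{\mathcal A}$$ into direct sums (not necessarily orthogonal) of closed submodules such that $F(M_1)\subseteq M_2$, $F(N_1)\subseteq N_2$, and $F|_{M_1}:M_1\to M_2$ is an isomorphism (of topological $\mathcal A$-modules). Let $\mathcal M\Phi_+(H_{\mathcal A})$, $\mathcal M\Phi_-(H_{\mathcal A})$ and $\mathcal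 M\Phi(H_{\mathcal A})$ be the sets of those $F\in B^a(H_{\mathcal A})$ that admit such a decomposition in which, respectively, $N_1$ is finitely generated over $\mathcal A$, $N_2$ is finitely generated over $\mathcal A$, and both $N_1$ and $N_2$ are finitely generated over $\mathcal A$. A two-sided ideal in a multiplicative semigroup $T$ is a (possibly empty) subset $I\subseteq T$ with $ab\in I$ and $ba\in I$ for all $a\in T$, $b\in I$. Then $\mathcal M\Phi_+(H_{\mathcal A})$ and $\mathcal M\Phi_-(H_{\mathcal A})$ are semigroups under multiplication (composition), $\mathcal M\Phi_+(H_{\mathcal A})\setminus\mathcal M\Phi(H_{\mathcal A})$ is a two-sided ideal in $\mathcal M\Phi_+(H_{\mathcal A})$, and $\mathcal M\Phi_-(H_{\mathcal A})\setminus\mathcal M\Phi(H_{\mathcal A})$ is a two-sided ideal in $\mathcal M\Phi_-(H_{\mathcal A})$. In particular, $\mathcal M\Phi_+(H_{\mathcal A})\setminus\mathcal M\Phi(H_{\mathcal A})$ and $\mathcal M\Phi_-(H_{\mathcal A})\setminus\mathcal M\Phi(H_{\mathcal A})$ are closed under multiplication, that is, they are multiplicative semigroups. -/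

import Mathlib

noncomputable section

namespace StandardHilbertModule

section Algebra

variable (A : Type*) [CStarAlgebra A] [PartialOrder A] [StarOrderedRing A]

variable {A} in
/-- A family of elements of a C⋆-algebra squeezed between zero and a summable family is summable. -/
theorem summable_of_nonneg_of_le {f g : ℕ → A} (h0 : ∀ i, 0 ≤ f i) (hfg : ∀ i, f i ≤ g i)
    (hg : Summable g) : Summable f := by
  rw [summable_iff_vanishing_norm] at hg ⊢
  intro ε hε
  obtain ⟨s, hs⟩ := hg ε hε
  exact ⟨s, fun t ht => (CStarAlgebra.norm_le_norm_of_nonneg_of_le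
    (Finset.sum_nonneg fun i _ => h0 i) (Finset.sum_le_sum fun i _ => hfg i)).trans_lt (hs t ht)⟩

/-- The sequences `x` in `A` for which `∑ i, x i * star (x i)` converges in norm. (For series with
positive terms, unconditional convergence and convergence of the partial sums agree.) -/
def l2Submodule : Submodule A (ℕ → A) where
  carrier := {x | Summable fun i => x i * star (x i)}
  zero_mem' := by simp
  add_mem' {x y} hx hy := by
    refine summable_of_nonneg_of_le (fun i => mul_star_self_nonneg _) (fun i => ?_)
      ((hx.add hy).add (hx.add hy))
    have h : 0 ≤ (x i - y i) * star (x i - y i) := mul_star_self_nonneg _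
    rw [← sub_nonneg]
    convert h using 1
    simp only [Pi.add_apply, star_add, star_sub]
    noncomm_ring
  smul_mem' a x hx := by
    have h := (Summable.mul_left a hx).mul_right (star a)
    simpa [mul_assoc] using h

end Algebra

/-- The standard Hilbert C⋆-module `H_A = ℓ²(A)` over a unital C⋆-algebra `A`. Mathlib's convention
for Hilbert C⋆-modules is used: `A` acts by coordinatewise left multiplication, and
`⟪x, y⟫ = ∑ i, y i * star (x i)`. (Replacing `A` by its opposite algebra gives the convention with a
right action and `⟪x, y⟫ = ∑ i, star (x i) * y i`.) The topology is that of the Hilbert module norm,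
defined below, and not the product topology. -/
def HA (A : Type*) [CStarAlgebra A] [PartialOrder A] [StarOrderedRing A] : Type _ :=
  ↥(l2Submodule A)

section Module

variable {A : Type*} [CStarAlgebra A] [PartialOrder A] [StarOrderedRing A]

instance : AddCommGroup (HA A) := inferInstanceAs (AddCommGroup ↥(l2Submodule A))

instance : Module A (HA A) := inferInstanceAs (Module A ↥(l2Submodule A))

instance : Module ℂ (HA A) := inferInstanceAs (Module ℂ ↥(l2Submodule A))

instance : IsScalarTower ℂ A (HA A) := inferInstanceAs (IsScalarTower ℂ A ↥(l2Submodule A))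

instance : CoeFun (HA A) (fun _ => ℕ → A) := ⟨Subtype.val⟩

namespace HA

@[ext] theorem ext {x y : HA A} (h : ∀ i, x i = y i) : x = y := Subtype.ext (funext h)

@[simp] theorem zero_apply (i : ℕ) : (0 : HA A) i = 0 := rfl

@[simp] theorem add_apply (x y : HA A) (i : ℕ) : (x + y) i = x i + y i := rfl

@[simp] theorem smul_apply (a : A) (x : HA A) (i : ℕ) : (a • x) i = a * x i := rfl

@[simp] theorem complex_smul_apply (z : ℂ) (x : HA A) (i : ℕ) : (z • x) i = z • x i := rfl

theorem summable_self (x : HA A) : Summable fun i => x i * star (x i) := x.2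

/-- The series defining the inner product converges, by polarization. -/
theorem summable_inner (x y : HA A) : Summable fun i => y i * star (x i) := by
  have h := ((((y + x).summable_self.sub (y + (-1 : ℂ) • x).summable_self).add
    (((y + Complex.I • x).summable_self.sub
      (y + (-Complex.I) • x).summable_self).const_smul Complex.I))).const_smul ((1 : ℂ) / 4)
  refine h.congr fun i => ?_
  simp only [add_apply, complex_smul_apply, star_add, star_smul, mul_add, add_mul,
    smul_mul_assoc, mul_smul_comm, smul_add, smul_sub, smul_smul, Complex.star_def, map_neg,
    map_one, Complex.conj_I]
  match_scalars <;> (ring_nf; try (rw [Complex.I_sq]; ring))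

/-- The Hilbert module norm `‖x‖ = ‖⟪x, x⟫‖ ^ (1/2)`. -/
instance : Norm (HA A) := ⟨fun x => √‖∑' i, x i * star (x i)‖⟩

instance : CStarModule A (HA A) where
  inner x y := ∑' i, y i * star (x i)
  inner_add_right {x y z} := by
    refine HasSum.tsum_eq ?_
    simpa [add_mul] using (summable_inner x y).hasSum.add (summable_inner x z).hasSum
  inner_self_nonneg {x} := tsum_nonneg fun i => mul_star_self_nonneg (x i)
  inner_self {x} := by
    constructor
    · intro h
      ext i
      have hle := x.summable_self.le_tsum i fun j _ => mul_star_self_nonneg (x j)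
      rw [h] at hle
      exact CStarRing.mul_star_self_eq_zero_iff _ |>.mp (le_antisymm hle (mul_star_self_nonneg _))
    · rintro rfl
      simp
  inner_op_smul_right {a x y} := by
    refine HasSum.tsum_eq ?_
    simpa [mul_assoc] using (summable_inner x y).hasSum.mul_left a
  inner_smul_right_complex {z x y} := by
    refine HasSum.tsum_eq ?_
    simpa using (summable_inner x y).hasSum.const_smul z
  star_inner x y := by
    refine ((summable_inner y x).hasSum.unique ?_).symm
    simpa using (summable_inner x y).hasSum.star
  norm_eq_sqrt_norm_inner_self _ := rfl

theorem inner_def (x y : HA A) : inner A x y = ∑' i, y i * star (x i) := rfl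

theorem hasSum_inner (x y : HA A) : HasSum (fun i => y i * star (x i)) (inner A x y) :=
  (summable_inner x y).hasSum

instance : NormedAddCommGroup (HA A) :=
  NormedAddCommGroup.ofCore (𝕜 := ℂ) (CStarModule.normedSpaceCore A)

instance : NormedSpace ℂ (HA A) := .ofCore (CStarModule.normedSpaceCore A)

end HA

end Module

section Operators

variable (A : Type*) [CStarAlgebra A] [PartialOrder A] [StarOrderedRing A]

/-- The bounded adjointable operators `Bᵃ(H_A)`: the bounded `A`-linear operators `F` on `H_A` for
which there is a bounded `A`-linear `G` with `⟪F x, y⟫ = ⟪x, G y⟫`; multiplication is composition. -/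
def Ba : Subring (HA A →L[A] HA A) where
  carrier := {F | ∃ G : HA A →L[A] HA A, ∀ x y : HA A, (inner A (F x) y : A) = inner A x (G y)}
  one_mem' := ⟨1, fun _ _ => rfl⟩
  zero_mem' := ⟨0, fun _ _ => by simp⟩
  add_mem' := by
    rintro F₁ F₂ ⟨G₁, h₁⟩ ⟨G₂, h₂⟩
    exact ⟨G₁ + G₂, fun x y => by simp [h₁, h₂]⟩
  neg_mem' := by
    rintro F ⟨G, h⟩
    exact ⟨-G, fun x y => by simp [h]⟩
  mul_mem' := by
    rintro F₁ F₂ ⟨G₁, h₁⟩ ⟨G₂, h₂⟩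
    exact ⟨G₂ * G₁, fun x y => by simp [h₁, h₂]⟩

variable {A}

/-- `H_A = M₁ ⊕ N₁` and `H_A = M₂ ⊕ N₂` are (not necessarily orthogonal) direct sum decompositions
into closed submodules with respect to which `F` has the block diagonal matrix `diag(F₁, F₄)`, with
`F₁ : M₁ → M₂` an isomorphism. -/
structure IsDiagonalDecomposition (F : HA A →L[A] HA A) (M₁ N₁ M₂ N₂ : Submodule A (HA A)) :
    Prop where
  isClosed_M₁ : IsClosed (M₁ : Set (HA A))
  isClosed_N₁ : IsClosed (N₁ : Set (HA A))
  isClosed_M₂ : IsClosed (M₂ : Set (HA A))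
  isClosed_N₂ : IsClosed (N₂ : Set (HA A))
  isCompl_domain : IsCompl M₁ N₁
  isCompl_range : IsCompl M₂ N₂
  exists_iso : ∃ F₁ : M₁ ≃L[A] M₂, ∀ x : M₁, F x = F₁ x
  map_N₁ : ∀ x ∈ N₁, F x ∈ N₂

variable (A)

/-- The upper semi-`A`-Fredholm operators `MΦ₊(H_A)`. -/
def MPhiPlus : Set (Ba A) :=
  {F | ∃ M₁ N₁ M₂ N₂ : Submodule A (HA A),
    IsDiagonalDecomposition (F : HA A →L[A] HA A) M₁ N₁ M₂ N₂ ∧ N₁.FG}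

/-- The lower semi-`A`-Fredholm operators `MΦ₋(H_A)`. -/
def MPhiMinus : Set (Ba A) :=
  {F | ∃ M₁ N₁ M₂ N₂ : Submodule A (HA A),
    IsDiagonalDecomposition (F : HA A →L[A] HA A) M₁ N₁ M₂ N₂ ∧ N₂.FG}

/-- The `A`-Fredholm operators `MΦ(H_A)`. -/
def MPhi : Set (Ba A) :=
  {F | ∃ M₁ N₁ M₂ N₂ : Submodule A (HA A),
    IsDiagonalDecomposition (F : HA A →L[A] HA A) M₁ N₁ M₂ N₂ ∧ N₁.FG ∧ N₂.FG}

end Operators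

section Semigroups

variable {S : Type*} [Mul S]

/-- The set `T` is a semigroup under the multiplication of `S`. -/
def IsMulSemigroup (T : Set S) : Prop := ∀ a ∈ T, ∀ b ∈ T, a * b ∈ T

/-- The set `I` is a two-sided ideal in the multiplicative semigroup `T`. -/
structure IsTwoSidedIdealIn (I T : Set S) : Prop where
  isMulSemigroup : IsMulSemigroup T
  subset : I ⊆ T
  mul_mem_left : ∀ a ∈ T, ∀ b ∈ I, a * b ∈ I
  mul_mem_right : ∀ a ∈ I, ∀ b ∈ T, a * b ∈ I

end Semigroups

end StandardHilbertModule

end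

/-! Modulo the two-sided ideal of finite rank operators, `MΦ₊` consists of the left invertible
elements, `MΦ₋` of the right invertible ones, and `MΦ` of those that are both. The theorem then
becomes monoid algebra: one-sided invertible elements are closed under products, and if a product of
two left (or two right) invertible elements is invertible, so is each factor.

From a decomposition to an inverse: the direct sums are not orthogonal and their projections are not
known to be adjointable, so an inverse cannot be read off the blocks. Instead, let `S` be a finite
rank operator with range `N₁` (or `N₂`). The open mapping theorem gives a lower bound for `F` and
the adjoint `S'` of `S` jointly (or for the adjoint `F'` and `S'`). Then `F' * F + S * S'` (or `F *
F' + S * S'`) is symmetric and bounded below, hence invertible, and its inverse yields the one-sided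
inverse modulo finite rank.

From an inverse to a decomposition: a finite rank `K` is nearly unchanged by a coordinate truncation
`P` on the appropriate side. A Neumann series then corrects the inverse to some `G` with `G * F * G
= G`. The idempotents `G * F` and `F * G` diagonalize `F`, and the relevant kernels are finitely
generated because the projections onto them factor through finite rank operators. -/

noncomputable section

namespace StandardHilbertModule

variable {A : Type*} [CStarAlgebra A] [PartialOrder A] [StarOrderedRing A]

/-! ### Norm estimates and completeness of `H_A`. -/

namespace HA

@[simp] theorem sub_apply (x y : HA A) (i : ℕ) : (x - y) i = x i - y i := rfl

theorem norm_sq_eq (x : HA A) : ‖x‖ ^ 2 = ‖∑' i, x i * star (x i)‖ :=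
  Real.sq_sqrt (norm_nonneg _)

theorem norm_sq_eq_inner (x : HA A) : ‖x‖ ^ 2 = ‖(inner A x x : A)‖ := norm_sq_eq x

theorem norm_sum_le (x : HA A) (s : Finset ℕ) :
    ‖∑ i ∈ s, x i * star (x i)‖ ≤ ‖x‖ ^ 2 := by
  rw [norm_sq_eq]
  exact CStarAlgebra.norm_le_norm_of_nonneg_of_le
    (Finset.sum_nonneg fun i _ => mul_star_self_nonneg _)
    (x.summable_self.sum_le_tsum s fun i _ => mul_star_self_nonneg _)

theorem norm_apply_le (x : HA A) (i : ℕ) : ‖x i‖ ≤ ‖x‖ := by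
  have h := norm_sum_le x {i}
  rw [Finset.sum_singleton, CStarRing.norm_self_mul_star, ← sq] at h
  exact (sq_le_sq₀ (norm_nonneg _) (norm_nonneg _)).1 h

theorem norm_le_of_norm_sum_le {x : HA A} {c : ℝ} (hc : 0 ≤ c)
    (h : ∀ n, ‖∑ i ∈ Finset.range n, x i * star (x i)‖ ≤ c ^ 2) : ‖x‖ ≤ c := by
  rw [← sq_le_sq₀ (norm_nonneg _) hc, norm_sq_eq]
  exact le_of_tendsto x.summable_self.hasSum.tendsto_sum_nat.norm (Filter.Eventually.of_forall h)

/-- The parallelogram law for `b` and `b - a`: the right side minus the left side is the square of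
`b + (b - a)`. -/
theorem mul_star_le_two_add (a b : A) :
    a * star a ≤ (b * star b + b * star b) +
      ((b - a) * star (b - a) + (b - a) * star (b - a)) := by
  have h : 0 ≤ (b + (b - a)) * star (b + (b - a)) := mul_star_self_nonneg _
  rw [← sub_nonneg]
  convert h using 1
  simp only [star_add, star_sub]
  noncomm_ring

instance : CompleteSpace (HA A) := by
  refine Metric.complete_of_cauchySeq_tendsto fun u hu => ?_
  have hcoord : ∀ i, ∃ a : A, Filter.Tendsto (fun k => u k i) Filter.atTop (nhds a) := by
    intro i
    refine cauchySeq_tendsto_of_complete (Metric.cauchySeq_iff.2 fun ε hε => ?_)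
    obtain ⟨N, hN⟩ := Metric.cauchySeq_iff.1 hu ε hε
    refine ⟨N, fun m hm n hn => lt_of_le_of_lt ?_ (hN m hm n hn)⟩
    rw [dist_eq_norm, dist_eq_norm]
    exact norm_apply_le (u m - u n) i
  choose v hv using hcoord
  have hbound : ∀ ε > 0, ∃ N, ∀ k ≥ N, ∀ s : Finset ℕ,
      ‖∑ i ∈ s, (u k i - v i) * star (u k i - v i)‖ ≤ ε ^ 2 := by
    intro ε hε
    obtain ⟨N, hN⟩ := Metric.cauchySeq_iff.1 hu ε hε
    refine ⟨N, fun k hk s => ?_⟩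
    -- For a finite `s` the Cauchy estimate passes to the limit in `l`; its bound does not depend on
    -- `s`.
    have ht : Filter.Tendsto (fun l => ‖∑ i ∈ s, (u k i - u l i) * star (u k i - u l i)‖)
        Filter.atTop (nhds ‖∑ i ∈ s, (u k i - v i) * star (u k i - v i)‖) := by
      refine (tendsto_finsetSum _ fun i _ => ?_).norm
      have h1 := (tendsto_const_nhds (x := u k i)).sub (hv i)
      exact h1.mul h1.star
    refine le_of_tendsto ht (Filter.eventually_atTop.2 ⟨N, fun l hl => ?_⟩)
    refine (norm_sum_le (u k - u l) s).trans ?_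
    have := hN k hk l hl
    rw [dist_eq_norm] at this
    gcongr
  have hsum : Summable fun i => v i * star (v i) := by
    rw [summable_iff_vanishing_norm]
    intro ε hε
    -- The tail of `v` is at most twice a tail of `u N` plus twice an error sum: `2 * (ε / 4) + 2 *
    -- (ε / 8) < ε`.
    have hε' : 0 < √(ε / 8) := by positivity
    obtain ⟨N, hN⟩ := hbound _ hε'
    obtain ⟨s, hs⟩ := summable_iff_vanishing_norm.1 (u N).summable_self (ε / 4) (by positivity)
    refine ⟨s, fun t ht => ?_⟩
    have h1 := hs t ht
    have h2 := hN N le_rfl t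
    rw [Real.sq_sqrt (by positivity)] at h2
    have h3 : ‖∑ i ∈ t, v i * star (v i)‖ ≤
        ‖(∑ i ∈ t, u N i * star (u N i) + ∑ i ∈ t, u N i * star (u N i)) +
        (∑ i ∈ t, (u N i - v i) * star (u N i - v i) +
          ∑ i ∈ t, (u N i - v i) * star (u N i - v i))‖ := by
      refine CStarAlgebra.norm_le_norm_of_nonneg_of_le
        (Finset.sum_nonneg fun i _ => mul_star_self_nonneg _) ?_
      rw [← Finset.sum_add_distrib, ← Finset.sum_add_distrib, ← Finset.sum_add_distrib]
      exact Finset.sum_le_sum fun i _ => mul_star_le_two_add _ _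
    refine h3.trans_lt ((norm_add_le _ _).trans_lt ?_)
    have h4 := norm_add_le (∑ i ∈ t, u N i * star (u N i)) (∑ i ∈ t, u N i * star (u N i))
    have h5 := norm_add_le (∑ i ∈ t, (u N i - v i) * star (u N i - v i))
      (∑ i ∈ t, (u N i - v i) * star (u N i - v i))
    linarith
  obtain ⟨w, hw⟩ : ∃ w : HA A, ∀ i, w i = v i := ⟨⟨v, hsum⟩, fun _ => rfl⟩
  refine ⟨w, Metric.tendsto_atTop.2 fun ε hε => ?_⟩
  obtain ⟨N, hN⟩ := hbound (ε / 2) (by positivity)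
  refine ⟨N, fun k hk => ?_⟩
  rw [dist_eq_norm]
  refine lt_of_le_of_lt (norm_le_of_norm_sum_le (c := ε / 2) (by positivity) fun n => ?_)
    (half_lt_self hε)
  simpa only [sub_apply, hw] using hN k hk (Finset.range n)

theorem norm_inner_le (x y : HA A) : ‖(inner A x y : A)‖ ≤ ‖x‖ * ‖y‖ :=
  CStarModule.norm_inner_le (HA A)

/-- The sequence with entry `1` at `i` and `0` elsewhere. -/
def basis (i : ℕ) : HA A :=
  ⟨Pi.single i 1, summable_of_ne_finset_zero (s := {i}) fun j hj => by
    simp [Pi.single_eq_of_ne (Finset.notMem_singleton.1 hj)]⟩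

theorem basis_apply (i j : ℕ) : (basis i : HA A) j = if j = i then 1 else 0 := by
  simp [basis, Pi.single_apply]

@[simp] theorem inner_basis_left (i : ℕ) (z : HA A) : (inner A (basis i) z : A) = z i := by
  rw [inner_def, tsum_eq_single i]
  · simp [basis_apply]
  · intro j hj
    simp [basis_apply, hj]

end HA

/-! ### Criteria for invertibility. -/

/-- The inverse of an `A`-linear bijection is `A`-linear, so invertibility can be tested in the
complex Banach algebra of bounded operators. -/
theorem isUnit_of_isUnit_restrictScalars {T : HA A →L[A] HA A}
    (h : IsUnit (T.restrictScalars ℂ)) : IsUnit T := by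
  obtain ⟨R, hR₁, hR₂⟩ := isUnit_iff_exists.1 h
  have h₁ : ∀ x, T (R x) = x := fun x => congr($hR₁ x)
  have h₂ : ∀ x, R (T x) = x := fun x => congr($hR₂ x)
  let R' : HA A →L[A] HA A :=
    { toFun := R
      map_add' := R.map_add
      map_smul' := fun a x => by
        have := h₂ (a • R x)
        rwa [map_smul, h₁] at this
      cont := R.continuous }
  exact isUnit_iff_exists.2 ⟨R', ContinuousLinearMap.ext h₁, ContinuousLinearMap.ext h₂⟩

theorem isUnit_of_norm_sub_le {T : HA A →L[A] HA A} (h : ∀ x, ‖x - T x‖ ≤ 1 / 2 * ‖x‖) :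
    IsUnit T := by
  refine isUnit_of_isUnit_restrictScalars ?_
  have h1 : ‖1 - T.restrictScalars ℂ‖ < 1 :=
    (ContinuousLinearMap.opNorm_le_bound _ (by norm_num) h).trans_lt (by norm_num)
  simpa using isUnit_one_sub_of_norm_lt_one h1

/-- Perturbing a symmetric operator by an imaginary scalar does not decrease norms. -/
theorem norm_apply_le_norm_smul_sub_apply {D : HA A →L[ℂ] HA A}
    (hD : ∀ x y, (inner A (D x) y : A) = inner A x (D y)) (t : ℝ) (x : HA A) :
    ‖D x‖ ≤ ‖((t * Complex.I : ℂ)) • x - D x‖ := by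
  rw [← sq_le_sq₀ (norm_nonneg _) (norm_nonneg _), HA.norm_sq_eq_inner, HA.norm_sq_eq_inner]
  refine CStarAlgebra.norm_le_norm_of_nonneg_of_le CStarModule.inner_self_nonneg ?_
  -- The cross terms cancel because `t * I` is imaginary and `D` is symmetric.
  have key : (inner A ((t * Complex.I : ℂ) • x - D x) ((t * Complex.I : ℂ) • x - D x) : A) =
      inner A (D x) (D x) + inner A ((t : ℂ) • x) ((t : ℂ) • x) := by
    simp only [CStarModule.inner_sub_left, CStarModule.inner_sub_right,
      CStarModule.inner_smul_left_complex, CStarModule.inner_smul_right_complex, hD x x, smul_sub,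
      smul_smul]
    match_scalars <;> simp
    ring_nf
    simp
  rw [key]
  exact le_add_of_nonneg_right CStarModule.inner_self_nonneg

/-- Continuity method along the imaginary axis: the set of `t` with `t * I - D` invertible is open,
is closed since the lower bound `c` persists and bounds all inverses by `c⁻¹`, and contains every
large `t`. Hence it contains `0`. -/
theorem isUnit_of_symmetric_of_le {D : HA A →L[ℂ] HA A}
    (hD : ∀ x y, (inner A (D x) y : A) = inner A x (D y)) {c : ℝ} (hc : 0 < c)
    (h : ∀ x, c * ‖x‖ ≤ ‖D x‖) : IsUnit D := by
  let f : ℝ → (HA A →L[ℂ] HA A) := fun t => algebraMap ℂ _ (t * Complex.I : ℂ) - D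
  have hf : Continuous f := by
    refine ((continuous_algebraMap ℂ (HA A →L[ℂ] HA A)).comp ?_).sub continuous_const
    fun_prop
  have hfx : ∀ t x, f t x = ((t * Complex.I : ℂ)) • x - D x := fun t x => by
    simp [f, Algebra.algebraMap_eq_smul_one]
  have hle : ∀ t x, c * ‖x‖ ≤ ‖f t x‖ := fun t x => by
    rw [hfx]
    exact (h x).trans (norm_apply_le_norm_smul_sub_apply hD t x)
  have hopen : IsOpen {t | IsUnit (f t)} := Units.isOpen.preimage hf
  have hclosed : IsClosed {t | IsUnit (f t)} := by
    refine isClosed_of_closure_subset fun t ht => ?_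
    have hnhds : {s | ‖f t - f s‖ < c} ∈ nhds t :=
      (isOpen_lt (continuous_const.sub hf).norm continuous_const).mem_nhds
        (show ‖f t - f t‖ < c by rwa [sub_self, norm_zero])
    obtain ⟨s, hs, hs'⟩ := mem_closure_iff_nhds.1 ht _ hnhds
    obtain ⟨v, hv₁, hv₂⟩ := isUnit_iff_exists.1 (show IsUnit (f s) from hs')
    have hv : ‖v‖ ≤ c⁻¹ := by
      refine ContinuousLinearMap.opNorm_le_bound _ (by positivity) fun x => ?_
      have h1 := hle s (v x)
      have h2 : (f s) (v x) = x := congr($hv₁ x)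
      rw [h2] at h1
      rwa [inv_mul_eq_div, le_div_iff₀ hc, mul_comm]
    have h3 : ‖(f s - f t) * v‖ < 1 := by
      replace hs : ‖f t - f s‖ < c := hs
      rw [norm_sub_rev] at hs
      calc _ ≤ ‖f s - f t‖ * ‖v‖ := norm_mul_le _ _
        _ ≤ ‖f s - f t‖ * c⁻¹ := by gcongr
        _ < c * c⁻¹ := by gcongr
        _ = 1 := mul_inv_cancel₀ hc.ne'
    have h4 := (isUnit_one_sub_of_norm_lt_one h3).mul hs'
    have h5 : (1 - (f s - f t) * v) * f s = f t := by
      rw [sub_mul, mul_assoc, hv₂]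
      simp
    rwa [h5] at h4
  have hne : {t | IsUnit (f t)}.Nonempty := by
    obtain ⟨t, ht⟩ := exists_gt (‖D‖ * ‖(1 : HA A →L[ℂ] HA A)‖)
    refine ⟨t, ?_⟩
    refine spectrum.mem_resolventSet_of_norm_lt_mul (k := (t * Complex.I : ℂ)) (a := D) ?_
    have : |t| = t := abs_of_nonneg (le_trans (by positivity) ht.le)
    simpa [this] using ht
  have h0 : (0 : ℝ) ∈ {t | IsUnit (f t)} := by
    rw [IsClopen.eq_univ ⟨hclosed, hopen⟩ hne]
    trivial
  simpa [f] using h0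

namespace Ba

theorem exists_adjoint (F : Ba A) :
    ∃ G : Ba A, (∀ x y, (inner A (F.1 x) y : A) = inner A x (G.1 y)) ∧
      ∀ x y, (inner A (G.1 x) y : A) = inner A x (F.1 y) := by
  obtain ⟨G, hG⟩ := F.2
  have hG' : ∀ x y, (inner A (G x) y : A) = inner A x (F.1 y) := fun x y => by
    rw [← CStarModule.star_inner, ← hG, CStarModule.star_inner]
  exact ⟨⟨G, F.1, hG'⟩, hG, hG'⟩

/-- The inverse of a symmetric operator is symmetric, so it is adjointable as well. -/
theorem isUnit_of_symmetric_of_le {D : Ba A}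
    (hD : ∀ x y, (inner A (D.1 x) y : A) = inner A x (D.1 y)) {c : ℝ} (hc : 0 < c)
    (h : ∀ x, c * ‖x‖ ≤ ‖D.1 x‖) : IsUnit D := by
  obtain ⟨R, hR₁, hR₂⟩ := isUnit_iff_exists.1 <| isUnit_of_isUnit_restrictScalars <|
    StandardHilbertModule.isUnit_of_symmetric_of_le (D := D.1.restrictScalars ℂ) hD hc h
  have hR : ∀ x, D.1 (R x) = x := fun x => congr($hR₁ x)
  refine isUnit_iff_exists.2 ⟨⟨R, R, fun x y => ?_⟩, Subtype.ext hR₁, Subtype.ext hR₂⟩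
  rw [← hR y, ← hD, hR, hR]

/-- If `T₁` and `T₂` have adjoints `S₁` and `S₂` that are jointly bounded below, then
`T₁ * S₁ + T₂ * S₂` is invertible. -/
theorem isUnit_mul_adjoint_add {T₁ S₁ T₂ S₂ : Ba A}
    (h₁ : ∀ x y, (inner A (T₁.1 x) y : A) = inner A x (S₁.1 y))
    (h₂ : ∀ x y, (inner A (T₂.1 x) y : A) = inner A x (S₂.1 y)) {C : ℝ} (hC : 0 < C)
    (h : ∀ x, ‖x‖ ≤ C * (‖S₁.1 x‖ + ‖S₂.1 x‖)) : IsUnit (T₁ * S₁ + T₂ * S₂) := by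
  have h₁' : ∀ x y, (inner A (S₁.1 x) y : A) = inner A x (T₁.1 y) := fun x y => by
    rw [← CStarModule.star_inner, ← h₁, CStarModule.star_inner]
  have h₂' : ∀ x y, (inner A (S₂.1 x) y : A) = inner A x (T₂.1 y) := fun x y => by
    rw [← CStarModule.star_inner, ← h₂, CStarModule.star_inner]
  have happ : ∀ x, (T₁ * S₁ + T₂ * S₂).1 x = T₁.1 (S₁.1 x) + T₂.1 (S₂.1 x) := fun _ => rfl
  refine isUnit_of_symmetric_of_le (c := ((2 * C) ^ 2)⁻¹) (fun x y => ?_) (by positivity)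
    fun x => ?_
  · simp only [happ, CStarModule.inner_add_left, CStarModule.inner_add_right, h₁, h₂, h₁', h₂']
  · set d := ‖(T₁ * S₁ + T₂ * S₂).1 x‖ with hd
    have hin : (inner A x ((T₁ * S₁ + T₂ * S₂).1 x) : A) =
        inner A (S₁.1 x) (S₁.1 x) + inner A (S₂.1 x) (S₂.1 x) := by
      rw [happ, CStarModule.inner_add_right, h₁', h₂']
    have hnorm := HA.norm_inner_le x ((T₁ * S₁ + T₂ * S₂).1 x)
    rw [hin] at hnorm
    have hs₁ : ‖S₁.1 x‖ ^ 2 ≤ ‖x‖ * d := by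
      rw [HA.norm_sq_eq_inner]
      exact (CStarAlgebra.norm_le_norm_of_nonneg_of_le CStarModule.inner_self_nonneg
        (le_add_of_nonneg_right CStarModule.inner_self_nonneg)).trans hnorm
    have hs₂ : ‖S₂.1 x‖ ^ 2 ≤ ‖x‖ * d := by
      rw [HA.norm_sq_eq_inner]
      exact (CStarAlgebra.norm_le_norm_of_nonneg_of_le CStarModule.inner_self_nonneg
        (le_add_of_nonneg_left CStarModule.inner_self_nonneg)).trans hnorm
    have h1 : ‖x‖ ^ 2 ≤ C ^ 2 * (‖S₁.1 x‖ + ‖S₂.1 x‖) ^ 2 := by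
      rw [← mul_pow]
      exact pow_le_pow_left₀ (norm_nonneg _) (h x) 2
    have h2 : (‖S₁.1 x‖ + ‖S₂.1 x‖) ^ 2 ≤ 4 * (‖x‖ * d) := by
      nlinarith [sq_nonneg (‖S₁.1 x‖ - ‖S₂.1 x‖)]
    have h3 : ‖x‖ * ‖x‖ ≤ ‖x‖ * ((2 * C) ^ 2 * d) := by
      nlinarith [mul_le_mul_of_nonneg_left h2 (sq_nonneg C)]
    rw [inv_mul_le_iff₀ (by positivity)]
    rcases (norm_nonneg x).eq_or_lt with h0 | h0
    · rw [← h0]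
      positivity
    · exact le_of_mul_le_mul_left h3 h0

end Ba

/-! ### Finite rank operators and coordinate truncations. -/

namespace HA

theorem norm_smul_le (a : A) (x : HA A) : ‖a • x‖ ≤ ‖a‖ * ‖x‖ := by
  rw [← sq_le_sq₀ (norm_nonneg _) (by positivity), mul_pow, norm_sq_eq_inner, norm_sq_eq_inner,
    CStarModule.inner_op_smul_right, CStarModule.inner_op_smul_left]
  calc _ ≤ ‖a‖ * (‖(inner A x x : A)‖ * ‖star a‖) :=
        (norm_mul_le _ _).trans (by gcongr; exact norm_mul_le _ _)
    _ = ‖a‖ ^ 2 * ‖(inner A x x : A)‖ := by rw [norm_star]; ring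

end HA

/-- The rank one operator `z ↦ ⟪y, z⟫ • x`. -/
def rankOneCLM (x y : HA A) : HA A →L[A] HA A where
  toFun z := (inner A y z : A) • x
  map_add' := by simp [add_smul]
  map_smul' := by simp [mul_smul]
  cont := by
    refine AddMonoidHomClass.continuous_of_bound
      (⟨⟨fun z => (inner A y z : A) • x, by simp⟩, by simp [add_smul]⟩ : HA A →+ HA A)
      (‖y‖ * ‖x‖) fun z => ?_
    refine (HA.norm_smul_le _ _).trans ?_
    rw [mul_right_comm]
    gcongr
    exact HA.norm_inner_le _ _

theorem inner_rankOneCLM (x y z w : HA A) :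
    (inner A (rankOneCLM x y z) w : A) = inner A z (rankOneCLM y x w) := by
  change (inner A ((inner A y z : A) • x) w : A) = inner A z ((inner A x w : A) • y)
  simp

/-- The rank one operator `z ↦ ⟪y, z⟫ • x`, as an adjointable operator. -/
def rankOne (x y : HA A) : Ba A := ⟨rankOneCLM x y, rankOneCLM y x, inner_rankOneCLM x y⟩

theorem rankOne_apply (x y z : HA A) : (rankOne x y).1 z = (inner A y z : A) • x := rfl

variable (A) in
/-- The ideal of finite rank operators. -/
def finiteRank : AddSubgroup (Ba A) :=
  AddSubgroup.closure {K | ∃ x y, K = rankOne x y}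

theorem rankOne_mem (x y : HA A) : rankOne x y ∈ finiteRank A :=
  AddSubgroup.subset_closure ⟨x, y, rfl⟩

theorem mul_mem_finiteRank_left (T : Ba A) {K : Ba A} (hK : K ∈ finiteRank A) :
    T * K ∈ finiteRank A := by
  induction hK using AddSubgroup.closure_induction with
  | mem K h =>
    obtain ⟨x, y, rfl⟩ := h
    convert rankOne_mem (T.1 x) y
    exact Subtype.ext (ContinuousLinearMap.ext fun z => map_smul T.1 (inner A y z : A) x)
  | zero => simp [zero_mem]
  | add K L _ _ hK hL => rw [mul_add]; exact add_mem hK hL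
  | neg K _ hK => rw [mul_neg]; exact neg_mem hK

theorem mul_mem_finiteRank_right (T : Ba A) {K : Ba A} (hK : K ∈ finiteRank A) :
    K * T ∈ finiteRank A := by
  induction hK using AddSubgroup.closure_induction with
  | mem K h =>
    obtain ⟨x, y, rfl⟩ := h
    obtain ⟨S, -, hS⟩ := Ba.exists_adjoint T
    convert rankOne_mem x (S.1 y)
    refine Subtype.ext (ContinuousLinearMap.ext fun z => ?_)
    change (inner A y (T.1 z) : A) • x = (inner A (S.1 y) z : A) • x
    rw [hS]
  | zero => simp [zero_mem]
  | add K L _ _ hK hL => rw [add_mul]; exact add_mem hK hL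
  | neg K _ hK => rw [neg_mul]; exact neg_mem hK

theorem exists_fg_of_mem_finiteRank {K : Ba A} (hK : K ∈ finiteRank A) :
    ∃ W : Submodule A (HA A), W.FG ∧ ∀ z, K.1 z ∈ W := by
  induction hK using AddSubgroup.closure_induction with
  | mem K h =>
    obtain ⟨x, y, rfl⟩ := h
    exact ⟨_, Submodule.fg_span_singleton x,
      fun z => Submodule.smul_mem _ _ (Submodule.mem_span_singleton_self x)⟩
  | zero => exact ⟨⊥, Submodule.fg_bot, fun z => Submodule.zero_mem _⟩
  | add K L _ _ hK hL =>
    obtain ⟨W, hW, hKW⟩ := hK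
    obtain ⟨V, hV, hLV⟩ := hL
    exact ⟨W ⊔ V, hW.sup hV, fun z => Submodule.add_mem_sup (hKW z) (hLV z)⟩
  | neg K _ hK =>
    obtain ⟨W, hW, hKW⟩ := hK
    exact ⟨W, hW, fun z => W.neg_mem (hKW z)⟩

/-- A submodule onto which a map that factors through a finite rank operator projects is finitely
generated. -/
theorem fg_of_projection {N : Submodule A (HA A)} (T : HA A →L[A] HA A) {K : Ba A}
    (hK : K ∈ finiteRank A) (hTN : ∀ x, T x ∈ N) (hT : ∀ x ∈ N, T x = x)
    (hTK : ∀ x, T (K.1 x) = T x) : N.FG := by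
  obtain ⟨W, hW, hKW⟩ := exists_fg_of_mem_finiteRank hK
  convert hW.map (T : HA A →ₗ[A] HA A)
  refine le_antisymm (fun x hx => ?_) ?_
  · exact ⟨K.1 x, hKW x, (hTK x).trans (hT x hx)⟩
  · rintro _ ⟨x, -, rfl⟩
    exact hTN x

/-- Generators `s i` of `N` give the operator `x ↦ ∑ i, x i • s i`, which uses only the first `n`
coordinates. -/
theorem exists_finiteRank_range_eq {N : Submodule A (HA A)} (hN : N.FG) :
    ∃ S ∈ finiteRank A, (∀ x, S.1 x ∈ N) ∧ ∀ x ∈ N, ∃ y, S.1 y = x := by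
  obtain ⟨n, s, rfl⟩ := Submodule.fg_iff_exists_fin_generating_family.1 hN
  have happ : ∀ x, (∑ i : Fin n, rankOne (s i) (HA.basis i)).1 x = ∑ i : Fin n, x i • s i := by
    intro x
    have h : (∑ i : Fin n, rankOne (s i) (HA.basis i)).1 =
        ∑ i : Fin n, (rankOne (s i) (HA.basis i)).1 := AddSubmonoidClass.coe_finsetSum _ _
    rw [h, sum_apply]
    simp [rankOne_apply]
  refine ⟨∑ i : Fin n, rankOne (s i) (HA.basis i), sum_mem fun i _ => rankOne_mem _ _,
    fun x => ?_, fun x hx => ?_⟩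
  · rw [happ]
    exact sum_mem fun i _ => Submodule.smul_mem _ _ (Submodule.subset_span ⟨i, rfl⟩)
  · obtain ⟨c, rfl⟩ := (Submodule.mem_span_range_iff_exists_fun A).1 hx
    refine ⟨∑ i : Fin n, c i • HA.basis i, ?_⟩
    rw [happ]
    refine Finset.sum_congr rfl fun i _ => ?_
    rw [← HA.inner_basis_left, CStarModule.inner_sum_right, Finset.sum_eq_single i]
    · simp [HA.basis_apply]
    · intro j _ hj
      simp [HA.basis_apply, Fin.val_inj, hj.symm]
    · simp

/-- The projection onto the first `n` coordinates. -/
def truncate (n : ℕ) : Ba A := ∑ i ∈ Finset.range n, rankOne (HA.basis i) (HA.basis i)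

theorem truncate_mem (n : ℕ) : truncate n ∈ finiteRank A := sum_mem fun _ _ => rankOne_mem _ _

theorem truncate_apply (n : ℕ) (x : HA A) (j : ℕ) :
    (truncate n).1 x j = if j < n then x j else 0 := by
  have h : (truncate n : Ba A).1 =
      ∑ i ∈ Finset.range n, (rankOne (HA.basis i) (HA.basis i)).1 :=
    AddSubmonoidClass.coe_finsetSum _ _
  rw [h, sum_apply, ← HA.inner_basis_left, CStarModule.inner_sum_right]
  simp [rankOne_apply, HA.basis_apply]

theorem truncate_mul_self (n : ℕ) : (truncate n * truncate n : Ba A) = truncate n := by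
  refine Subtype.ext (ContinuousLinearMap.ext fun x => HA.ext fun j => ?_)
  change (truncate n).1 ((truncate n).1 x) j = _
  simp only [truncate_apply]
  split_ifs <;> rfl

theorem inner_truncate (n : ℕ) (x y : HA A) :
    (inner A ((truncate n).1 x) y : A) = inner A x ((truncate n).1 y) := by
  simp only [HA.inner_def, truncate_apply]
  congr 1
  ext i
  split_ifs <;> simp

theorem eventually_norm_sub_truncate_le (x : HA A) {ε : ℝ} (hε : 0 < ε) :
    ∀ᶠ n in Filter.atTop, ‖x - (truncate n).1 x‖ ≤ ε := by
  obtain ⟨s, hs⟩ := summable_iff_vanishing_norm.1 x.summable_self (ε ^ 2) (by positivity)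
  obtain ⟨N, hN⟩ := s.exists_nat_subset_range
  refine Filter.eventually_atTop.2 ⟨N, fun n hn => ?_⟩
  refine HA.norm_le_of_norm_sum_le hε.le fun m => ?_
  have h : ∑ i ∈ Finset.range m, (x - (truncate n).1 x) i * star ((x - (truncate n).1 x) i) =
      ∑ i ∈ Finset.range m with n ≤ i, x i * star (x i) := by
    rw [Finset.sum_filter]
    refine Finset.sum_congr rfl fun i _ => ?_
    rw [HA.sub_apply, truncate_apply]
    by_cases hi : i < n
    · simp [hi, not_le.2 hi]
    · simp [hi, not_lt.1 hi]
  rw [h]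
  refine (hs _ (Finset.disjoint_left.2 fun i hi his => ?_)).le
  have h1 := (Finset.mem_filter.1 hi).2
  have h2 := Finset.mem_range.1 (hN his)
  omega

/-- For the rank one operator of `x` and `y` the error is a multiple of `x - P x`, with coefficient
bounded by `‖y‖ * ‖z‖`; the estimate is stable under sums and negation. -/
theorem eventually_norm_sub_truncate_mul_le {K : Ba A} (hK : K ∈ finiteRank A) {ε : ℝ}
    (hε : 0 < ε) : ∀ᶠ n in Filter.atTop, ∀ x, ‖K.1 x - (truncate n).1 (K.1 x)‖ ≤ ε * ‖x‖ := by
  induction hK using AddSubgroup.closure_induction generalizing ε with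
  | mem K h =>
    obtain ⟨x, y, rfl⟩ := h
    filter_upwards [eventually_norm_sub_truncate_le x (ε := ε / (‖y‖ + 1)) (by positivity)]
      with n hn z
    rw [rankOne_apply, map_smul, ← smul_sub]
    calc _ ≤ ‖(inner A y z : A)‖ * ‖x - (truncate n).1 x‖ := HA.norm_smul_le _ _
      _ ≤ ((‖y‖ + 1) * ‖z‖) * (ε / (‖y‖ + 1)) := by
        gcongr
        exact (HA.norm_inner_le y z).trans (by gcongr; linarith)
      _ = ε * ‖z‖ := by field_simp
  | zero =>
    refine Filter.Eventually.of_forall fun n x => ?_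
    change ‖(0 : HA A) - (truncate n).1 0‖ ≤ _
    rw [map_zero, sub_zero, norm_zero]
    positivity
  | add K L _ _ hK hL =>
    filter_upwards [hK (half_pos hε), hL (half_pos hε)] with n h₁ h₂ x
    change ‖(K.1 x + L.1 x) - (truncate n).1 (K.1 x + L.1 x)‖ ≤ _
    rw [map_add, add_sub_add_comm]
    exact (norm_add_le _ _).trans (by linarith [h₁ x, h₂ x])
  | neg K _ hK =>
    filter_upwards [hK hε] with n h x
    change ‖(-K.1 x) - (truncate n).1 (-K.1 x)‖ ≤ _
    rw [map_neg, ← neg_sub', norm_neg]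
    exact h x

/-- The mirror estimate: truncation is symmetric, so it moves from the argument to the vector `y` of
the rank one operator. -/
theorem eventually_norm_mul_sub_truncate_le {K : Ba A} (hK : K ∈ finiteRank A) {ε : ℝ}
    (hε : 0 < ε) : ∀ᶠ n in Filter.atTop, ∀ x, ‖K.1 (x - (truncate n).1 x)‖ ≤ ε * ‖x‖ := by
  induction hK using AddSubgroup.closure_induction generalizing ε with
  | mem K h =>
    obtain ⟨x, y, rfl⟩ := h
    filter_upwards [eventually_norm_sub_truncate_le y (ε := ε / (‖x‖ + 1)) (by positivity)]
      with n hn z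
    rw [rankOne_apply, CStarModule.inner_sub_right, ← inner_truncate, ← CStarModule.inner_sub_left]
    calc _ ≤ ‖(inner A (y - (truncate n).1 y) z : A)‖ * ‖x‖ := HA.norm_smul_le _ _
      _ ≤ (ε / (‖x‖ + 1) * ‖z‖) * (‖x‖ + 1) := by
        gcongr
        · exact (HA.norm_inner_le _ z).trans (by gcongr)
        · linarith
      _ = ε * ‖z‖ := by field_simp
  | zero =>
    refine Filter.Eventually.of_forall fun n x => ?_
    change ‖(0 : HA A)‖ ≤ _
    rw [norm_zero]
    positivity
  | add K L _ _ hK hL =>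
    filter_upwards [hK (half_pos hε), hL (half_pos hε)] with n h₁ h₂ x
    exact (norm_add_le _ _).trans ((add_le_add (h₁ x) (h₂ x)).trans_eq (by ring))
  | neg K _ hK =>
    filter_upwards [hK hε] with n h x
    exact (norm_neg _).trans_le (h x)

/-! ### Bounded decompositions from the open mapping theorem. -/

theorem exists_bounded_preimage {E : Type*} [NormedAddCommGroup E] [NormedSpace ℂ E]
    [CompleteSpace E] {M : Submodule A (HA A)} (hM : IsClosed (M : Set (HA A)))
    (S : E →L[ℂ] HA A) (hS : ∀ x, S x ∈ M) (hS' : ∀ x ∈ M, ∃ y, S y = x) :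
    ∃ C > 0, ∀ x ∈ M, ∃ y, S y = x ∧ ‖y‖ ≤ C * ‖x‖ := by
  have := hM.completeSpace_coe
  let S' : E →L[ℂ] M.restrictScalars ℂ := S.codRestrict _ hS
  have : CompleteSpace (M.restrictScalars ℂ) := hM.completeSpace_coe
  obtain ⟨C, hC, h⟩ := S'.exists_preimage_norm_le fun x => by
    obtain ⟨y, hy⟩ := hS' x x.2
    exact ⟨y, Subtype.ext hy⟩
  refine ⟨C, hC, fun x hx => ?_⟩
  obtain ⟨y, hy, hy'⟩ := h ⟨x, hx⟩
  exact ⟨y, congr_arg Subtype.val hy, hy'⟩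

theorem exists_bounded_decomposition {M N : Submodule A (HA A)}
    (hM : IsClosed (M : Set (HA A))) (hN : IsClosed (N : Set (HA A))) (h : IsCompl M N) :
    ∃ C > 0, ∀ x, ∃ m ∈ M, ∃ n ∈ N, m + n = x ∧ ‖m‖ ≤ C * ‖x‖ ∧ ‖n‖ ≤ C * ‖x‖ := by
  have : CompleteSpace (M.restrictScalars ℂ) := hM.completeSpace_coe
  have : CompleteSpace (N.restrictScalars ℂ) := hN.completeSpace_coe
  obtain ⟨C, hC, hb⟩ := exists_bounded_preimage (M := (⊤ : Submodule A (HA A))) isClosed_univ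
    ((M.restrictScalars ℂ).subtypeL.coprod (N.restrictScalars ℂ).subtypeL)
    (fun _ => trivial) fun x _ => by
      obtain ⟨m, hm, n, hn, hx⟩ := Submodule.mem_sup.1 (h.sup_eq_top ▸ Submodule.mem_top : x ∈ M ⊔ N)
      exact ⟨(⟨m, hm⟩, ⟨n, hn⟩), hx⟩
  refine ⟨C, hC, fun x => ?_⟩
  obtain ⟨⟨m, n⟩, hx, hle⟩ := hb x trivial
  exact ⟨m, m.2, n, n.2, hx, (norm_fst_le (m, n)).trans hle, (norm_snd_le (m, n)).trans hle⟩

namespace IsDiagonalDecomposition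

variable {F : HA A →L[A] HA A} {M₁ N₁ M₂ N₂ : Submodule A (HA A)}

theorem exists_norm_le (h : IsDiagonalDecomposition F M₁ N₁ M₂ N₂) :
    ∃ C > 0, ∀ y ∈ M₂, ∃ x ∈ M₁, F x = y ∧ ‖x‖ ≤ C * ‖y‖ := by
  obtain ⟨F₁, hF₁⟩ := h.exists_iso
  have : CompleteSpace (M₁.restrictScalars ℂ) := h.isClosed_M₁.completeSpace_coe
  obtain ⟨C, hC, hb⟩ := exists_bounded_preimage h.isClosed_M₂
    ((F.restrictScalars ℂ).comp (M₁.restrictScalars ℂ).subtypeL)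
    (fun x => (hF₁ x).symm ▸ (F₁ x).2 : ∀ x : M₁, F x ∈ M₂)
    fun y hy => ⟨F₁.symm ⟨y, hy⟩, (hF₁ _).trans (by rw [F₁.apply_symm_apply])⟩
  refine ⟨C, hC, fun y hy => ?_⟩
  obtain ⟨x, hx, hle⟩ := hb y hy
  exact ⟨x, x.2, hx, hle⟩

theorem injOn (h : IsDiagonalDecomposition F M₁ N₁ M₂ N₂) {x y : HA A} (hx : x ∈ M₁)
    (hy : y ∈ M₁) (hxy : F x = F y) : x = y := by
  obtain ⟨F₁, hF₁⟩ := h.exists_iso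
  have : F₁ ⟨x, hx⟩ = F₁ ⟨y, hy⟩ := by
    rw [Subtype.ext_iff, ← hF₁, ← hF₁]
    exact hxy
  exact congr_arg Subtype.val (F₁.injective this)

theorem mapsTo (h : IsDiagonalDecomposition F M₁ N₁ M₂ N₂) {x : HA A} (hx : x ∈ M₁) :
    F x ∈ M₂ := by
  obtain ⟨F₁, hF₁⟩ := h.exists_iso
  exact hF₁ ⟨x, hx⟩ ▸ (F₁ ⟨x, hx⟩).2

/-- If `x = m + n` along `M₁ ⊕ N₁`, then `F m` is the `M₂`-component of `F x`, so `‖m‖` is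
controlled by `‖F x‖` and not merely by `‖x‖`. This is what bounds `F` below off `N₁`. -/
theorem exists_domain_decomposition (h : IsDiagonalDecomposition F M₁ N₁ M₂ N₂) :
    ∃ C > 0, ∀ x, ∃ m, ∃ n ∈ N₁, m + n = x ∧ ‖m‖ ≤ C * ‖F x‖ ∧ ‖n‖ ≤ C * ‖x‖ := by
  obtain ⟨C₁, hC₁, h₁⟩ :=
    exists_bounded_decomposition h.isClosed_M₁ h.isClosed_N₁ h.isCompl_domain
  obtain ⟨C₂, hC₂, h₂⟩ :=
    exists_bounded_decomposition h.isClosed_M₂ h.isClosed_N₂ h.isCompl_range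
  obtain ⟨C₃, hC₃, h₃⟩ := h.exists_norm_le
  refine ⟨C₁ + C₃ * C₂, by positivity, fun x => ?_⟩
  obtain ⟨m, hm, n, hn, hx, -, hle⟩ := h₁ x
  obtain ⟨a, ha, b, hb, hFx, hale, -⟩ := h₂ (F x)
  obtain ⟨m', hm', hFm', hm'le⟩ := h₃ a ha
  have hab : F m = a := by
    have h4 : F m - a ∈ N₂ := by
      have : F m - a = b - F n := by
        rw [← hx, map_add] at hFx
        rw [sub_eq_sub_iff_add_eq_add, ← hFx]
        abel
      exact this ▸ N₂.sub_mem hb (h.map_N₁ n hn)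
    exact sub_eq_zero.1
      (Submodule.disjoint_def.1 h.isCompl_range.disjoint _ (M₂.sub_mem (h.mapsTo hm) ha) h4)
  obtain rfl := h.injOn hm hm' (hab.trans hFm'.symm)
  refine ⟨m, n, hn, hx, ?_, hle.trans (by gcongr; exact le_add_of_nonneg_right (by positivity))⟩
  calc ‖m‖ ≤ C₃ * (C₂ * ‖F x‖) := hm'le.trans (by gcongr)
    _ ≤ (C₁ + C₃ * C₂) * ‖F x‖ := by
      rw [← mul_assoc]
      gcongr
      exact le_add_of_nonneg_left hC₁.le

theorem exists_range_decomposition (h : IsDiagonalDecomposition F M₁ N₁ M₂ N₂) :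
    ∃ C > 0, ∀ y, ∃ x, ∃ n ∈ N₂, F x + n = y ∧ ‖x‖ ≤ C * ‖y‖ ∧ ‖n‖ ≤ C * ‖y‖ := by
  obtain ⟨C₂, hC₂, h₂⟩ :=
    exists_bounded_decomposition h.isClosed_M₂ h.isClosed_N₂ h.isCompl_range
  obtain ⟨C₃, hC₃, h₃⟩ := h.exists_norm_le
  refine ⟨C₂ + C₃ * C₂, by positivity, fun y => ?_⟩
  obtain ⟨a, ha, b, hb, hy, hale, hble⟩ := h₂ y
  obtain ⟨x, -, hx, hxle⟩ := h₃ a ha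
  refine ⟨x, b, hb, by rw [hx, hy], ?_,
    hble.trans (by gcongr; exact le_add_of_nonneg_right (by positivity))⟩
  calc ‖x‖ ≤ C₃ * (C₂ * ‖y‖) := hxle.trans (by gcongr)
    _ ≤ (C₂ + C₃ * C₂) * ‖y‖ := by
      rw [← mul_assoc]
      gcongr
      exact le_add_of_nonneg_left hC₂.le

end IsDiagonalDecomposition

/-! ### Semi-Fredholm operators are one-sided invertible modulo finite rank. -/

theorem exists_finiteRank_bounded_range {N : Submodule A (HA A)}
    (hN : IsClosed (N : Set (HA A))) (hfg : N.FG) :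
    ∃ S ∈ finiteRank A, ∃ C > 0, ∀ x ∈ N, ∃ y, S.1 y = x ∧ ‖y‖ ≤ C * ‖x‖ := by
  obtain ⟨S, hS, h₁, h₂⟩ := exists_finiteRank_range_eq hfg
  exact ⟨S, hS, exists_bounded_preimage hN (S.1.restrictScalars ℂ) h₁ h₂⟩

/-- Expand `⟪x, x⟫` along `x = a + b` and divide by `‖x‖`. This turns a bounded decomposition of `x`
into the joint lower bound required by `Ba.isUnit_mul_adjoint_add`. -/
theorem norm_le_of_inner_decomposition {x a b : HA A} {u v c : ℝ} (hx : a + b = x)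
    (ha : ‖(inner A x a : A)‖ ≤ u * c * ‖x‖) (hb : ‖(inner A x b : A)‖ ≤ v * c * ‖x‖)
    (hc : 0 ≤ c * (u + v)) : ‖x‖ ≤ c * (u + v) := by
  rcases (norm_nonneg x).eq_or_lt with h0 | h0
  · rwa [← h0]
  · refine le_of_mul_le_mul_right ?_ h0
    rw [← sq, HA.norm_sq_eq_inner]
    calc ‖(inner A x x : A)‖ = ‖(inner A x a + inner A x b : A)‖ := by
          rw [← CStarModule.inner_add_right, hx]
      _ ≤ u * c * ‖x‖ + v * c * ‖x‖ := (norm_add_le _ _).trans (add_le_add ha hb)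
      _ = c * (u + v) * ‖x‖ := by ring

/-- An upper semi-Fredholm operator is left invertible modulo the finite rank operators. -/
theorem exists_mul_eq_one_sub_of_mem_MPhiPlus {F : Ba A} (hF : F ∈ MPhiPlus A) :
    ∃ L, ∃ K ∈ finiteRank A, L * F = 1 - K := by
  obtain ⟨M₁, N₁, M₂, N₂, h, hfg⟩ := hF
  obtain ⟨S, hS, C₁, hC₁, h₁⟩ := exists_finiteRank_bounded_range h.isClosed_N₁ hfg
  obtain ⟨C₂, hC₂, h₂⟩ := h.exists_domain_decomposition
  obtain ⟨F', -, hF'⟩ := Ba.exists_adjoint F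
  obtain ⟨S', hS', -⟩ := Ba.exists_adjoint S
  have hunit : IsUnit (F' * F + S * S') := by
    refine Ba.isUnit_mul_adjoint_add (C := C₂ + C₁ * C₂) hF' hS' (by positivity) fun x => ?_
    obtain ⟨m, n, hn, hx, hm, hnle⟩ := h₂ x
    obtain ⟨y, rfl, hy⟩ := h₁ n hn
    refine norm_le_of_inner_decomposition hx ?_ ?_ (by positivity)
    · calc _ ≤ ‖x‖ * (C₂ * ‖F.1 x‖) := (HA.norm_inner_le _ _).trans (by gcongr)
        _ ≤ ‖x‖ * ((C₂ + C₁ * C₂) * ‖F.1 x‖) := by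
          gcongr
          exact le_add_of_nonneg_right (by positivity)
        _ = _ := by ring
    · have hS'' : (inner A x (S.1 y) : A) = inner A (S'.1 x) y := by
        rw [← CStarModule.star_inner, hS', CStarModule.star_inner]
      rw [hS'']
      calc _ ≤ ‖S'.1 x‖ * (C₁ * (C₂ * ‖x‖)) :=
            (HA.norm_inner_le _ _).trans (by gcongr; exact hy.trans (by gcongr))
        _ ≤ ‖S'.1 x‖ * ((C₂ + C₁ * C₂) * ‖x‖) := by
          rw [← mul_assoc C₁]
          gcongr
          exact le_add_of_nonneg_left hC₂.le
        _ = _ := by ring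
  -- From `R * (F' * F + S * S') = 1`, the operator `R * F'` is a left inverse with finite rank
  -- error `R * (S * S')`.
  obtain ⟨R, -, hR⟩ := isUnit_iff_exists.1 hunit
  refine ⟨R * F', R * (S * S'),
    mul_mem_finiteRank_left _ (mul_mem_finiteRank_right _ hS), ?_⟩
  rw [eq_sub_iff_add_eq, mul_assoc, ← mul_add, hR]

/-- A lower semi-Fredholm operator is right invertible modulo the finite rank operators. -/
theorem exists_mul_eq_one_sub_of_mem_MPhiMinus {F : Ba A} (hF : F ∈ MPhiMinus A) :
    ∃ R, ∃ K ∈ finiteRank A, F * R = 1 - K := by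
  obtain ⟨M₁, N₁, M₂, N₂, h, hfg⟩ := hF
  obtain ⟨S, hS, C₁, hC₁, h₁⟩ := exists_finiteRank_bounded_range h.isClosed_N₂ hfg
  obtain ⟨C₂, hC₂, h₂⟩ := h.exists_range_decomposition
  obtain ⟨F', hF', -⟩ := Ba.exists_adjoint F
  obtain ⟨S', hS', -⟩ := Ba.exists_adjoint S
  have hunit : IsUnit (F * F' + S * S') := by
    refine Ba.isUnit_mul_adjoint_add (C := C₂ + C₁ * C₂) hF' hS' (by positivity) fun x => ?_
    obtain ⟨m, n, hn, hx, hm, hnle⟩ := h₂ x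
    obtain ⟨y, rfl, hy⟩ := h₁ n hn
    refine norm_le_of_inner_decomposition hx ?_ ?_ (by positivity)
    · have hF'' : (inner A x (F.1 m) : A) = inner A (F'.1 x) m := by
        rw [← CStarModule.star_inner, hF', CStarModule.star_inner]
      rw [hF'']
      calc _ ≤ ‖F'.1 x‖ * (C₂ * ‖x‖) := (HA.norm_inner_le _ _).trans (by gcongr)
        _ ≤ ‖F'.1 x‖ * ((C₂ + C₁ * C₂) * ‖x‖) := by
          gcongr
          exact le_add_of_nonneg_right (by positivity)
        _ = _ := by ring
    · have hS'' : (inner A x (S.1 y) : A) = inner A (S'.1 x) y := by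
        rw [← CStarModule.star_inner, hS', CStarModule.star_inner]
      rw [hS'']
      calc _ ≤ ‖S'.1 x‖ * (C₁ * (C₂ * ‖x‖)) :=
            (HA.norm_inner_le _ _).trans (by gcongr; exact hy.trans (by gcongr))
        _ ≤ ‖S'.1 x‖ * ((C₂ + C₁ * C₂) * ‖x‖) := by
          rw [← mul_assoc C₁]
          gcongr
          exact le_add_of_nonneg_left hC₂.le
        _ = _ := by ring
  obtain ⟨R, hR, -⟩ := isUnit_iff_exists.1 hunit
  refine ⟨F' * R, S * S' * R,
    mul_mem_finiteRank_right _ (mul_mem_finiteRank_right _ hS), ?_⟩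
  rw [eq_sub_iff_add_eq, ← mul_assoc, ← add_mul, hR]

/-! ### Decompositions from one-sided inverses modulo finite rank. -/

/-- A bounded outer inverse `G` of `F` diagonalizes `F`. -/
theorem isDiagonalDecomposition_of_mul_mul_eq {F G : HA A →L[A] HA A} (h : G * F * G = G) :
    IsDiagonalDecomposition F (1 - G * F).ker (G * F).ker (1 - F * G).ker (F * G).ker := by
  have hG : ∀ x, G (F (G x)) = G x := fun x => congr($h x)
  have mem₁ : ∀ x, x ∈ (1 - G * F).ker ↔ G (F x) = x := fun x => by
    rw [eq_comm, ← sub_eq_zero]; rfl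
  have mem₂ : ∀ x, x ∈ (1 - F * G).ker ↔ F (G x) = x := fun x => by
    rw [eq_comm, ← sub_eq_zero]; rfl
  have mem₃ : ∀ x, x ∈ (G * F).ker ↔ G (F x) = 0 := fun x => Iff.rfl
  have mem₄ : ∀ x, x ∈ (F * G).ker ↔ F (G x) = 0 := fun x => Iff.rfl
  refine ⟨(1 - G * F).isClosed_ker, (G * F).isClosed_ker, (1 - F * G).isClosed_ker,
    (F * G).isClosed_ker, IsCompl.of_eq ?_ ?_, IsCompl.of_eq ?_ ?_, ?_, ?_⟩
  · refine (Submodule.eq_bot_iff _).2 fun x hx => ?_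
    exact ((mem₁ x).1 hx.1).symm.trans hx.2
  · refine (Submodule.eq_top_iff').2 fun x => Submodule.mem_sup.2
      ⟨G (F x), (mem₁ _).2 (hG _), x - G (F x), (mem₃ _).2 ?_, by abel⟩
    rw [map_sub, map_sub, hG, sub_self]
  · refine (Submodule.eq_bot_iff _).2 fun x hx => ?_
    exact ((mem₂ x).1 hx.1).symm.trans hx.2
  · refine (Submodule.eq_top_iff').2 fun x => Submodule.mem_sup.2
      ⟨F (G x), (mem₂ _).2 (by rw [hG]), x - F (G x), (mem₄ _).2 ?_, by abel⟩
    rw [map_sub, map_sub, hG, sub_self]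
  -- On the fixed spaces of the idempotents `G * F` and `F * G`, the maps `F` and `G` are mutually
  -- inverse.
  · refine ⟨ContinuousLinearEquiv.equivOfInverse
      ((F.comp (1 - G * F).ker.subtypeL).codRestrict _ fun x =>
        (mem₂ _).2 (congr_arg F ((mem₁ _).1 x.2)))
      ((G.comp (1 - F * G).ker.subtypeL).codRestrict _ fun x => (mem₁ _).2 (hG _))
      (fun x => Subtype.ext ((mem₁ _).1 x.2)) (fun x => Subtype.ext ((mem₂ _).1 x.2)),
      fun x => rfl⟩
  · intro x hx
    rw [mem₄, (mem₃ x).1 hx, map_zero]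

/-- A left inverse modulo finite rank operators can be corrected to an outer inverse that is a left
inverse on a cofinite coordinate submodule. -/
theorem exists_outer_inverse_of_mul_eq_one_sub {F L K : Ba A} (hK : K ∈ finiteRank A)
    (h : L * F = 1 - K) : ∃ (G : HA A →L[A] HA A) (n : ℕ), G * F.1 * G = G ∧
      (1 - G * F.1) * (truncate n).1 = 1 - G * F.1 := by
  obtain ⟨n, hn⟩ := (eventually_norm_mul_sub_truncate_le hK (ε := 1 / 2) (by norm_num)).exists
  set P := (truncate n : Ba A).1
  have hP : P * P = P := congr_arg Subtype.val (truncate_mul_self n)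
  have h' : L.1 * F.1 = 1 - K.1 := congr_arg Subtype.val h
  obtain ⟨V, -, hV⟩ := isUnit_iff_exists.1 <|
    isUnit_of_norm_sub_le (T := 1 - K.1 * (1 - P)) fun x => by
      change ‖x - (x - K.1 (x - P x))‖ ≤ _
      rw [sub_sub_cancel]
      exact hn x
  have hQ : (1 - P) * (1 - P) = 1 - P := by
    simp only [mul_sub, sub_mul, mul_one, one_mul, hP]
    abel
  -- On the range of `1 - P`, `L * F` agrees with `1 - K * (1 - P)`, which `V` inverts. The leading
  -- factor `1 - P` in `G` then forces `G * F * G = G`. Boundedness of `G` suffices, since the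
  -- decomposition needs no adjoint.
  have hLQ : (1 - P) * V * L.1 * F.1 * (1 - P) = 1 - P := by
    have h1 : (1 - K.1) * (1 - P) = (1 - K.1 * (1 - P)) * (1 - P) := by
      rw [sub_mul, sub_mul _ _ (1 - P), mul_assoc K.1, hQ]
    rw [mul_assoc _ L.1, h', mul_assoc, h1, mul_assoc (1 - P), ← mul_assoc V, hV, one_mul, hQ]
  refine ⟨(1 - P) * V * L.1, n, ?_, ?_⟩
  · calc (1 - P) * V * L.1 * F.1 * ((1 - P) * V * L.1)
        = (1 - P) * V * L.1 * F.1 * (1 - P) * (V * L.1) := by simp only [mul_assoc]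
      _ = (1 - P) * V * L.1 := by rw [hLQ, mul_assoc]
  · have h2 : (1 - (1 - P) * V * L.1 * F.1) * (1 - P) = 0 := by
      rw [sub_mul, hLQ, one_mul, sub_self]
    rw [mul_sub, mul_one, sub_eq_zero] at h2
    exact h2.symm

/-- Operators that are left invertible modulo finite rank operators are upper semi-Fredholm, and
Fredholm if they are also right invertible modulo finite rank operators. -/
theorem mem_MPhiPlus_of_mul_eq_one_sub {F L K : Ba A} (hK : K ∈ finiteRank A)
    (h : L * F = 1 - K) :
    F ∈ MPhiPlus A ∧ ((∃ R, ∃ K' ∈ finiteRank A, F * R = 1 - K') → F ∈ MPhi A) := by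
  obtain ⟨G, n, hG, hP⟩ := exists_outer_inverse_of_mul_eq_one_sub hK h
  have hG' : ∀ x, G (F.1 (G x)) = G x := fun x => congr($hG x)
  have hP' : ∀ x, (truncate n).1 x - G (F.1 ((truncate n).1 x)) = x - G (F.1 x) :=
    fun x => congr($hP x)
  have hdec := isDiagonalDecomposition_of_mul_mul_eq hG
  have hfg : (G * F.1).ker.FG := by
    refine fg_of_projection (1 - G * F.1) (truncate_mem n) (fun x => ?_) (fun x hx => ?_) hP'
    · change G (F.1 (x - G (F.1 x))) = 0
      rw [map_sub, map_sub, hG', sub_self]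
    · change x - G (F.1 x) = x
      rw [show G (F.1 x) = 0 from hx, sub_zero]
  refine ⟨⟨_, _, _, _, hdec, hfg⟩, ?_⟩
  rintro ⟨R, K', hK', hR⟩
  have hR' : ∀ x, F.1 (R.1 x) = x - K'.1 x := fun x => congr(($hR).1 x)
  -- Write `x = F (R x) + K' x`. Since `(1 - F * G) * F = F * (1 - G * F)` is unchanged by `P` on
  -- the right, `1 - F * G` factors through `F * P * R + K'`.
  refine ⟨_, _, _, _, hdec, hfg, fg_of_projection (1 - F.1 * G)
    (add_mem (mul_mem_finiteRank_right R (mul_mem_finiteRank_left F (truncate_mem n))) hK')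
    (fun x => ?_) (fun x hx => ?_) fun x => ?_⟩
  · change F.1 (G (x - F.1 (G x))) = 0
    rw [map_sub, hG', sub_self, map_zero]
  · change x - F.1 (G x) = x
    rw [show F.1 (G x) = 0 from hx, sub_zero]
  · have h1 := congr_arg F.1 (hP' (R.1 x))
    rw [map_sub, map_sub, hR'] at h1
    change (F.1 ((truncate n).1 (R.1 x)) + K'.1 x) -
      F.1 (G (F.1 ((truncate n).1 (R.1 x)) + K'.1 x)) = x - F.1 (G x)
    rw [map_add, map_add, add_sub_add_comm, h1, map_sub, map_sub]
    abel

/-- Operators that are right invertible modulo finite rank operators are lower semi-Fredholm. -/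
theorem mem_MPhiMinus_of_mul_eq_one_sub {F R K : Ba A} (hK : K ∈ finiteRank A)
    (h : F * R = 1 - K) : F ∈ MPhiMinus A := by
  obtain ⟨n, hn⟩ := (eventually_norm_sub_truncate_mul_le hK (ε := 1 / 2) (by norm_num)).exists
  set P := (truncate n : Ba A).1
  have hP : P * P = P := congr_arg Subtype.val (truncate_mul_self n)
  have h' : F.1 * R.1 = 1 - K.1 := congr_arg Subtype.val h
  obtain ⟨V, hV, -⟩ := isUnit_iff_exists.1 <|
    isUnit_of_norm_sub_le (T := 1 - (1 - P) * K.1) fun x => by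
      change ‖x - (x - (K.1 x - P (K.1 x)))‖ ≤ _
      rw [sub_sub_cancel]
      exact hn x
  have hQ : (1 - P) * (1 - P) = 1 - P := by
    simp only [mul_sub, sub_mul, mul_one, one_mul, hP]
    abel
  -- With `Q = 1 - P`, one has `Q * F * R = Q * (1 - K) = Q * (1 - Q * K)`, and `V` cancels the last
  -- factor.
  have hQR : (1 - P) * F.1 * (R.1 * V) = 1 - P := by
    have h1 : (1 - P) * (1 - K.1) = (1 - P) * (1 - (1 - P) * K.1) := by
      rw [mul_sub, mul_sub _ _ ((1 - P) * K.1), ← mul_assoc (1 - P) (1 - P), hQ]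
    rw [← mul_assoc, mul_assoc (1 - P), h', h1, mul_assoc, hV, mul_one]
  have hG : R.1 * V * (1 - P) * F.1 * (R.1 * V * (1 - P)) = R.1 * V * (1 - P) := by
    calc _ = R.1 * V * ((1 - P) * F.1 * (R.1 * V)) * (1 - P) := by simp only [mul_assoc]
      _ = _ := by rw [hQR, mul_assoc, hQ]
  have hQG : (1 - P) * (F.1 * (R.1 * V * (1 - P))) = 1 - P := by
    calc _ = (1 - P) * F.1 * (R.1 * V) * (1 - P) := by simp only [mul_assoc]
      _ = _ := by rw [hQR, hQ]
  have hPP : ∀ x, P (P x) = P x := fun x => congr($hP x)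
  -- Here `N₂ = ker (F * G)` is exactly the range of `P`: `G` ends in `1 - P`, and `(1 - P) * F * G
  -- = 1 - P`.
  refine ⟨_, _, _, _, isDiagonalDecomposition_of_mul_mul_eq hG,
    fg_of_projection P (truncate_mem n) (fun x => ?_) (fun x hx => ?_) hPP⟩
  · change F.1 (R.1 (V (P x - P (P x)))) = 0
    simp only [hPP, sub_self, map_zero]
  · have h1 : (1 - P) ((F.1 * (R.1 * V * (1 - P))) x) = x - P x := congr($hQG x)
    rw [show (F.1 * (R.1 * V * (1 - P))) x = 0 from hx, map_zero] at h1
    exact (sub_eq_zero.1 h1.symm).symm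

/-! ### The algebraic Calkin algebra and Atkinson's theorem. -/

variable (A) in
/-- The finite rank operators as a two-sided ideal. -/
def finiteRankIdeal : TwoSidedIdeal (Ba A) :=
  .mk' (finiteRank A : Set (Ba A)) (zero_mem _) add_mem neg_mem
    (fun {T _} hK => mul_mem_finiteRank_left T hK) fun {_ T} hK => mul_mem_finiteRank_right T hK

variable (A) in
/-- The algebraic Calkin algebra: adjointable operators modulo finite rank operators. -/
abbrev Calkin : Type _ := (finiteRankIdeal A).ringCon.Quotient

/-- The quotient map onto the Calkin algebra. -/
abbrev toCalkin : Ba A →+* Calkin A := (finiteRankIdeal A).ringCon.mk'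

theorem toCalkin_surjective : Function.Surjective (toCalkin (A := A)) :=
  (finiteRankIdeal A).ringCon.mk'_surjective

theorem toCalkin_eq_one_iff {T : Ba A} : toCalkin T = 1 ↔ ∃ K ∈ finiteRank A, T = 1 - K := by
  rw [← map_one toCalkin, eq_comm]
  refine ((finiteRankIdeal A).ringCon.eq.trans (TwoSidedIdeal.rel_iff _ _ _)).trans ?_
  rw [finiteRankIdeal, TwoSidedIdeal.mem_mk']
  refine ⟨fun h => ⟨1 - T, h, (sub_sub_cancel _ _).symm⟩, ?_⟩
  rintro ⟨K, hK, rfl⟩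
  simpa using hK

theorem exists_mul_toCalkin_eq_one_iff {F : Ba A} :
    (∃ l, l * toCalkin F = 1) ↔ ∃ L, ∃ K ∈ finiteRank A, L * F = 1 - K := by
  simp only [toCalkin_surjective.exists, ← map_mul, toCalkin_eq_one_iff]

theorem exists_toCalkin_mul_eq_one_iff {F : Ba A} :
    (∃ r, toCalkin F * r = 1) ↔ ∃ R, ∃ K ∈ finiteRank A, F * R = 1 - K := by
  simp only [toCalkin_surjective.exists, ← map_mul, toCalkin_eq_one_iff]

theorem mem_MPhiPlus_iff {F : Ba A} : F ∈ MPhiPlus A ↔ ∃ l, l * toCalkin F = 1 := by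
  rw [exists_mul_toCalkin_eq_one_iff]
  exact ⟨exists_mul_eq_one_sub_of_mem_MPhiPlus,
    fun ⟨_, _, hK, h⟩ => (mem_MPhiPlus_of_mul_eq_one_sub hK h).1⟩

theorem mem_MPhiMinus_iff {F : Ba A} : F ∈ MPhiMinus A ↔ ∃ r, toCalkin F * r = 1 := by
  rw [exists_toCalkin_mul_eq_one_iff]
  exact ⟨exists_mul_eq_one_sub_of_mem_MPhiMinus,
    fun ⟨_, _, hK, h⟩ => mem_MPhiMinus_of_mul_eq_one_sub hK h⟩

/-- Atkinson's theorem. -/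
theorem mem_MPhi_iff {F : Ba A} :
    F ∈ MPhi A ↔ (∃ l, l * toCalkin F = 1) ∧ ∃ r, toCalkin F * r = 1 := by
  constructor
  · rintro ⟨M₁, N₁, M₂, N₂, h, h₁, h₂⟩
    exact ⟨mem_MPhiPlus_iff.1 ⟨M₁, N₁, M₂, N₂, h, h₁⟩,
      mem_MPhiMinus_iff.1 ⟨M₁, N₁, M₂, N₂, h, h₂⟩⟩
  · rintro ⟨hl, hr⟩
    obtain ⟨L, K, hK, h⟩ := exists_mul_toCalkin_eq_one_iff.1 hl
    exact (mem_MPhiPlus_of_mul_eq_one_sub hK h).2 (exists_toCalkin_mul_eq_one_iff.1 hr)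

/-! ### One-sided inverses in a monoid. -/

section Monoid

variable {M : Type*} [Monoid M] {a b : M}

theorem exists_left_inverse_mul (ha : ∃ l, l * a = 1) (hb : ∃ l, l * b = 1) :
    ∃ l, l * (a * b) = 1 := by
  obtain ⟨l, hl⟩ := ha
  obtain ⟨k, hk⟩ := hb
  exact ⟨k * l, by rw [mul_assoc, ← mul_assoc l, hl, one_mul, hk]⟩

theorem exists_right_inverse_mul (ha : ∃ r, a * r = 1) (hb : ∃ r, b * r = 1) :
    ∃ r, a * b * r = 1 := by
  obtain ⟨l, hl⟩ := ha
  obtain ⟨k, hk⟩ := hb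
  exact ⟨k * l, by rw [mul_assoc, ← mul_assoc b, hk, one_mul, hl]⟩

theorem exists_right_inverse_left_factor (hab : ∃ r, a * b * r = 1) : ∃ r, a * r = 1 := by
  obtain ⟨r, hr⟩ := hab
  exact ⟨b * r, by rw [← mul_assoc, hr]⟩

theorem exists_left_inverse_right_factor (hab : ∃ l, l * (a * b) = 1) : ∃ l, l * b = 1 := by
  obtain ⟨l, hl⟩ := hab
  exact ⟨l * a, by rw [mul_assoc, hl]⟩

/-- The left inverse `l` of `a` equals its right inverse `b * r`, so `b * (r * a) = l * a = 1`. -/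
theorem exists_right_inverse_right_factor (ha : ∃ l, l * a = 1) (hab : ∃ r, a * b * r = 1) :
    ∃ r, b * r = 1 := by
  obtain ⟨l, hl⟩ := ha
  obtain ⟨r, hr⟩ := hab
  have hla : l = b * r := left_inv_eq_right_inv hl (by rw [← mul_assoc, hr])
  exact ⟨r * a, by rw [← mul_assoc, ← hla, hl]⟩

theorem exists_left_inverse_left_factor (hb : ∃ r, b * r = 1) (hab : ∃ l, l * (a * b) = 1) :
    ∃ l, l * a = 1 := by
  obtain ⟨r, hr⟩ := hb
  obtain ⟨l, hl⟩ := hab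
  have hrl : l * a = r := left_inv_eq_right_inv (by rw [mul_assoc, hl]) hr
  exact ⟨b * l, by rw [mul_assoc, hrl, hr]⟩

end Monoid

/-! ### The ideals of properly semi-Fredholm operators. -/

theorem IsTwoSidedIdealIn.isMulSemigroup_ideal {S : Type*} [Mul S] {I T : Set S}
    (h : IsTwoSidedIdealIn I T) : IsMulSemigroup I :=
  fun a ha b hb => h.mul_mem_left a (h.subset ha) b hb

variable (A) in
theorem isTwoSidedIdealIn_MPhiPlus : IsTwoSidedIdealIn (MPhiPlus A \ MPhi A) (MPhiPlus A) := by
  have hmul : IsMulSemigroup (MPhiPlus A) := fun a ha b hb => by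
    rw [mem_MPhiPlus_iff] at ha hb ⊢
    rw [map_mul]
    exact exists_left_inverse_mul ha hb
  -- By contradiction: if the product were Fredholm, the factor assumed not Fredholm would acquire
  -- the right inverse it lacks.
  refine ⟨hmul, Set.sdiff_subset, fun a ha b hb => ⟨hmul a ha b hb.1, fun h => hb.2 ?_⟩,
    fun a ha b hb => ⟨hmul a ha.1 b hb, fun h => ha.2 ?_⟩⟩ <;>
    rw [mem_MPhi_iff, map_mul] at h
  · exact mem_MPhi_iff.2 ⟨mem_MPhiPlus_iff.1 hb.1,
      exists_right_inverse_right_factor (mem_MPhiPlus_iff.1 ha) h.2⟩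
  · exact mem_MPhi_iff.2 ⟨mem_MPhiPlus_iff.1 ha.1, exists_right_inverse_left_factor h.2⟩

variable (A) in
theorem isTwoSidedIdealIn_MPhiMinus :
    IsTwoSidedIdealIn (MPhiMinus A \ MPhi A) (MPhiMinus A) := by
  have hmul : IsMulSemigroup (MPhiMinus A) := fun a ha b hb => by
    rw [mem_MPhiMinus_iff] at ha hb ⊢
    rw [map_mul]
    exact exists_right_inverse_mul ha hb
  -- Dually, a Fredholm product would supply the missing left inverse.
  refine ⟨hmul, Set.sdiff_subset, fun a ha b hb => ⟨hmul a ha b hb.1, fun h => hb.2 ?_⟩,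
    fun a ha b hb => ⟨hmul a ha.1 b hb, fun h => ha.2 ?_⟩⟩ <;>
    rw [mem_MPhi_iff, map_mul] at h
  · exact mem_MPhi_iff.2 ⟨exists_left_inverse_right_factor h.1, mem_MPhiMinus_iff.1 hb.1⟩
  · exact mem_MPhi_iff.2 ⟨exists_left_inverse_left_factor (mem_MPhiMinus_iff.1 hb) h.1,
      mem_MPhiMinus_iff.1 ha.1⟩

end StandardHilbertModule

end

theorem corollary2p10 (A : Type*) [CStarAlgebra A] [PartialOrder A] [StarOrderedRing A] :
    StandardHilbertModule.IsTwoSidedIdealIn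
        (StandardHilbertModule.MPhiPlus A \ StandardHilbertModule.MPhi A)
        (StandardHilbertModule.MPhiPlus A) ∧
      StandardHilbertModule.IsTwoSidedIdealIn
        (StandardHilbertModule.MPhiMinus A \ StandardHilbertModule.MPhi A)
        (StandardHilbertModule.MPhiMinus A) ∧
      StandardHilbertModule.IsMulSemigroup
        (StandardHilbertModule.MPhiPlus A \ StandardHilbertModule.MPhi A) ∧
      StandardHilbertModule.IsMulSemigroup
        (StandardHilbertModule.MPhiMinus A \ StandardHilbertModule.MPhi A) := by
  exact ⟨StandardHilbertModule.isTwoSidedIdealIn_MPhiPlus A,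
    StandardHilbertModule.isTwoSidedIdealIn_MPhiMinus A,
    (StandardHilbertModule.isTwoSidedIdealIn_MPhiPlus A).isMulSemigroup_ideal,
    (StandardHilbertModule.isTwoSidedIdealIn_MPhiMinus A).isMulSemigroup_ideal⟩
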